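/- **Setting.** Let $\mathcal M$ be a complete (connected, finite-dimensional, smooth) Riemannian manifold with distance $d$. A geodesic is a curve of zero acceleration. A length-minimizing geodesic between $a$ and $b$ is a geodesic from $a$ to $b$ of length $d(a,b)$, and we say that the geodesic connecting $a$ and $b$ is unique if there is exactly one such geodesic (parametrized with unit speed). A sequence $(u_i)_{i=0}^n$ in $\mathcal M$ is *geodesic* if there are $L\ge 0$ and a unit-speed geodesic $\gamma:[0,L]\to\mathcal M$ with $\gamma(iL/n)=u_i$ for $0\le i\le n$ and $d(u_i,u_{i+1})=L/n$ for $0\le i<n$; it is *locally geodesic* if $(u_{i-1},u_i,u_{i+1})$ is geodesic for each $1\le i\le n-1$. A bivariate signal $u=(u_{i,j})_{0\le i<N_1,\,0\le j<N_2}$ is (locally) geodesic if all its rows, columns and antidiagonals $(u_{i_0+k,j_0-k})_k$ are (locally) geodesic. Fix $\alpha_0,\alpha_1>0$ and $p\in[1,\infty)$. For $D:\mathcal M^2\times\mathcal M^2\to[0,\infty)$ and $D^{\rm sym}:(\mathcal M^2)^4\to[0,\infty)$ define $$\text{M-TGV}^2_\alpha(u)=\min_{y^1,y^2}\ \alpha_1\sum_{i,j}\Big(d(u_{i+1,j},y^1_{i,j})^p+d(u_{i,j+1},y^2_{i,j})^p\Big)^{1/p}+\alpha_0\,R(u,y^1,y^2),$$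 $$R(u,y^1,y^2)=\sum_{i,j}\Big(D([u_{i,j},y^1_{i,j}],[u_{i-1,j},y^1_{i-1,j}])^p+D([u_{i,j},y^2_{i,j}],[u_{i,j-1},y^2_{i,j-1}])^p$$ $$\qquad\qquad+2^{1-p}D^{\rm sym}([u_{i,j},y^1_{i,j}],[u_{i,j},y^2_{i,j}],[u_{i,j-1},y^1_{i,j-1}],[u_{i-1,j},y^2_{i-1,j}])^p\Big)^{1/p},$$ where $y^1_{i,j}$ is defined for $i\le N_1-2$ and $y^2_{i,j}$ for $j\le N_2-2$, and every term that involves an out-of-bounds index is zero. ($\text{M-TGV}^2_\alpha(u)$ denotes the infimum if the minimum is not known to be attained.) Put $\mathrm{TV}(u)=\sum_{i,j}(d(u_{i+1,j},u_{i,j})^p+d(u_{i,j+1},u_{i,j})^p)^{1/p}$ and $\mathrm{TV}^2_{D}(u)=R(u,(u_{i+1,j})_{i,j},(u_{i,j+1})_{i,j})$. For $u$ with values in $\mathbb R^K$ let, with the same convention on indices, $\mathrm{D}u=(\delta_{x+}u,\delta_{y+}u)$ (forward differences), $\mathcal E w=(\delta_{x-}w^1,\delta_{y-}w^2,\tfrac12(\delta_{y-}w^1+\delta_{x-}w^2))$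 (backward differences), $\|w\|_1=\sum_{i,j}(|w^1_{i,j}|^p+|w^2_{i,j}|^p)^{1/p}$, $\|z\|_1=\sum_{i,j}(|z^1_{i,j}|^p+|z^2_{i,j}|^p+2|z^3_{i,j}|^p)^{1/p}$, $\mathrm{TGV}^2_\alpha(u)=\min_w\alpha_1\|\mathrm{D}u-w\|_1+\alpha_0\|\mathcal E w\|_1$ and $\mathrm{TV}^2(u)=\|\mathcal E\mathrm{D}u\|_1$. **Proposition.** Assume that for all points of $\mathcal M$ - $D([x,x],[u,u])=0$ and $D^{\rm sym}([x,x],[x,x],[u,u],[v,v])=0$; - in case $\mathcal M=\mathbb R^K$ (up to isometry): $D([x,y],[u,v])=|(y-x)-(v-u)|$ and $$D^{\rm sym}([x,y^1],[x,y^2],[u,\tilde y^1],[v,\tilde y^2])=\big|y^1-x-(\tilde y^1-u)+y^2-x-(\tilde y^2-v)\big| .$$ Then the following hold for all bivariate signals $u$ of any size $N_1\times N_2$. 1. (M-P1') If $\mathcal M=\mathbb R^K$, the minimum defining $\text{M-TGV}^2_\alpha(u)$ is attained and $\text{M-TGV}^2_\alpha(u)=\mathrm{TGV}^2_\alpha(u)$.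 2. (M-P2') If the minimum is attained at $y^1=y^2=u$, then $\text{M-TGV}^2_\alpha(u)=\alpha_1\mathrm{TV}(u)$. 3. (M-P3') If the minimum is attained at $y^1_{i,j}=u_{i+1,j}$, $y^2_{i,j}=u_{i,j+1}$, then $\text{M-TGV}^2_\alpha(u)=\alpha_0\mathrm{TV}^2_{D}(u)$; and $\mathrm{TV}^2_D$ is an admissible generalization of $\mathrm{TV}^2$, i.e. $\mathrm{TV}^2_D=\mathrm{TV}^2$ if $\mathcal M=\mathbb R^K$. 4. Suppose that $D([v_1,v_2],[v_0,v_1])=0$ for every geodesic three-point signal $v$, and that $$(*)\qquad D^{\rm sym}([v_{1,1},v_{2,1}],[v_{1,1},v_{1,2}],[v_{1,0},v_{2,0}],[v_{0,1},v_{0,2}])=0$$ for every geodesic three-by-three signal $v=(v_{i,j})_{0\le i,j\le 2}$ (i.e. one whose rows, columns and antidiagonal $(v_{k,2-k})_{k=0}^2$ are geodesic; the shorter antidiagonals have at most two points and are automatically geodesic). Then for every locally geodesic $u$ the minimum is attained and $\text{M-TGV}^2_\alpha(u)=0$. 5. Conversely, suppose that every three-point signal $v$ such that the geodesic connecting $v_i,v_{i'}$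 is unique whenever $|i-i'|\le1$, and with $D([v_1,v_2],[v_0,v_1])=0$, is geodesic; and that for every three-by-three signal $v$ such that the geodesic connecting each pair $v_{i,j},v_{i',j'}$ is unique and all rows and columns are geodesic, $(*)$ implies that $(v_{k,2-k})_{k=0}^2$ is geodesic. Then every $u$ such that the geodesic connecting $u_{i,j}$ and $u_{i',j'}$ is unique whenever $\max\{|i-i'|,|j-j'|\}\le2$, such that the minimum defining $\text{M-TGV}^2_\alpha(u)$ is attained, and such that $\text{M-TGV}^2_\alpha(u)=0$, is geodesic. -/

import Mathlib

open scoped NNReal ContDiff Manifold Bundle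

/-! ## Geodesics of a Riemannian manifold

`M` is a smooth `m`-dimensional manifold without boundary with a Riemannian metric on its tangent
bundle. -/

section Geodesics

variable (m : ℕ) {M : Type*} [MetricSpace M] [ChartedSpace (EuclideanSpace ℝ (Fin m)) M]
  [Bundle.RiemannianBundle (fun x : M => TangentSpace (𝓡 m) x)]

/-- The Riemannian metric `g_q(v, w)` in the coordinates of the preferred chart at `a`:
`q` is a point and `v, w` are vectors of the coordinate space `ℝ^m`. -/
noncomputable def coordMetric (a : M) (q v w : EuclideanSpace ℝ (Fin m)) : ℝ :=
  inner ℝ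
    (mfderiv (𝓡 m) (𝓡 m) (chartAt (EuclideanSpace ℝ (Fin m)) a).symm q v)
    (mfderiv (𝓡 m) (𝓡 m) (chartAt (EuclideanSpace ℝ (Fin m)) a).symm q w)

/-- The Christoffel symbols (of the first kind) of the Levi-Civita connection in the coordinates
of the chart at `a`, i.e. the number `g_q(Γ_q(v, w), z)`, given by
`(∂_v g(w, z) + ∂_w g(v, z) - ∂_z g(v, w)) / 2`. -/
noncomputable def christoffel (a : M) (q v w z : EuclideanSpace ℝ (Fin m)) : ℝ :=
  (fderiv ℝ (fun q' => coordMetric m a q' w z) q v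
    + fderiv ℝ (fun q' => coordMetric m a q' v z) q w
    - fderiv ℝ (fun q' => coordMetric m a q' v w) q z) / 2

/-- The covariant acceleration `D/dt γ'` of the curve `γ` vanishes at time `t`. In the coordinates
`x = φ ∘ γ` of the chart `φ` at `γ t`, the acceleration is `x'' + Γ(x', x')`; it is zero if and only
if its inner product with every vector `z` is zero. -/
def HasZeroAcceleration (γ : ℝ → M) (t : ℝ) : Prop :=
  let x : ℝ → EuclideanSpace ℝ (Fin m) :=
    fun s => chartAt (EuclideanSpace ℝ (Fin m)) (γ t) (γ s)
  ∀ z : EuclideanSpace ℝ (Fin m),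
    coordMetric m (γ t) (x t) (deriv (deriv x) t) z
      + christoffel m (γ t) (x t) (deriv x t) (deriv x t) z = 0

/-- `γ` restricted to `[0, L]` is a geodesic parametrized with unit speed: a smooth curve with zero
acceleration and unit speed (by continuity it suffices to ask for the latter two in the interior).
For `L = 0` this is a single point. -/
def IsUnitSpeedGeodesic (γ : ℝ → M) (L : ℝ) : Prop :=
  0 ≤ L ∧ ContMDiffOn 𝓘(ℝ, ℝ) (𝓡 m) ∞ γ (Set.Icc 0 L) ∧
    ∀ t ∈ Set.Ioo 0 L,
      HasZeroAcceleration m γ t ∧ ‖mfderiv 𝓘(ℝ, ℝ) (𝓡 m) γ t (1 : ℝ)‖ = 1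

/-- `γ` is a length minimizing geodesic from `a` to `b`: a unit speed geodesic, defined on an
interval of length `d(a, b)` (which is then the length of the curve), from `a` to `b`. -/
def IsMinimizingGeodesic (γ : ℝ → M) (a b : M) : Prop :=
  IsUnitSpeedGeodesic m γ (dist a b) ∧ γ 0 = a ∧ γ (dist a b) = b

/-- There is exactly one length minimizing geodesic from `a` to `b`. -/
def UniqueGeodesic (a b : M) : Prop :=
  ∃ γ : ℝ → M, IsMinimizingGeodesic m γ a b ∧
    ∀ γ' : ℝ → M, IsMinimizingGeodesic m γ' a b → Set.EqOn γ' γ (Set.Icc 0 (dist a b))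

/-- The finite sequence `u 0, …, u n` is geodesic: all points lie on one unit speed geodesic
`γ : [0, L] → M`, at the times `i L / n`, and consecutive points have distance `L / n`, i.e. `γ` is
length minimizing between them. -/
def IsGeodesicSeq (n : ℕ) (u : ℕ → M) : Prop :=
  ∃ (L : ℝ) (γ : ℝ → M), IsUnitSpeedGeodesic m γ L ∧
    (∀ i ≤ n, γ (i * L / n) = u i) ∧ ∀ i < n, dist (u i) (u (i + 1)) = L / n

/-- The finite sequence `u 0, …, u n` is locally geodesic: every three consecutive points form a
geodesic sequence. -/
def IsLocallyGeodesicSeq (n : ℕ) (u : ℕ → M) : Prop :=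
  ∀ i, i + 2 ≤ n → IsGeodesicSeq m 2 (fun k => u (i + k))

/-! A bivariate signal of size `N₁ × N₂` is represented by a function `u : ℕ → ℕ → M`, of which
only the values `u i j` with `i < N₁`, `j < N₂` matter. -/

/-- A bivariate signal is geodesic if all its rows, columns and antidiagonals
`k ↦ u (i + k) (j - k)` (as far as they lie in the grid) are geodesic. -/
def IsGeodesicSignal (N₁ N₂ : ℕ) (u : ℕ → ℕ → M) : Prop :=
  (∀ j < N₂, IsGeodesicSeq m (N₁ - 1) (fun i => u i j)) ∧
  (∀ i < N₁, IsGeodesicSeq m (N₂ - 1) (fun j => u i j)) ∧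
  ∀ i j n, i + n < N₁ → j < N₂ → n ≤ j → IsGeodesicSeq m n (fun k => u (i + k) (j - k))

/-- A bivariate signal is locally geodesic if all its rows, columns and antidiagonals are locally
geodesic. -/
def IsLocallyGeodesicSignal (N₁ N₂ : ℕ) (u : ℕ → ℕ → M) : Prop :=
  (∀ j < N₂, IsLocallyGeodesicSeq m (N₁ - 1) (fun i => u i j)) ∧
  (∀ i < N₁, IsLocallyGeodesicSeq m (N₂ - 1) (fun j => u i j)) ∧
  ∀ i j n, i + n < N₁ → j < N₂ → n ≤ j → IsLocallyGeodesicSeq m n (fun k => u (i + k) (j - k))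

end Geodesics

/-! ## Discrete second-order TGV in vector spaces

Terms that involve entries outside the grid are zero; the conditions `i + 1 < N₁` and so on single
out the terms inside. -/

section VectorSpace

variable {U : Type*} [NormedAddCommGroup U] [NormedSpace ℝ U]

/-- Forward difference in the first index. -/
def fwdX (u : ℕ → ℕ → U) (i j : ℕ) : U := u (i + 1) j - u i j

/-- Forward difference in the second index. -/
def fwdY (u : ℕ → ℕ → U) (i j : ℕ) : U := u i (j + 1) - u i j

/-- Backward difference in the first index (only used for `1 ≤ i`). -/
def bwdX (w : ℕ → ℕ → U) (i j : ℕ) : U := w i j - w (i - 1) j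

/-- Backward difference in the second index (only used for `1 ≤ j`). -/
def bwdY (w : ℕ → ℕ → U) (i j : ℕ) : U := w i j - w i (j - 1)

/-- The norm `∑ (|w¹|^p + |w²|^p)^(1/p)` of a vector field `w = (w¹, w²)`, where `w¹` lives on the
grid of the first, and `w²` on that of the second component of the discrete gradient. -/
noncomputable def vecNorm (p : ℝ) (N₁ N₂ : ℕ) (w₁ w₂ : ℕ → ℕ → U) : ℝ :=
  ∑ i ∈ Finset.range N₁, ∑ j ∈ Finset.range N₂,
    ((if i + 1 < N₁ then ‖w₁ i j‖ ^ p else 0) + (if j + 1 < N₂ then ‖w₂ i j‖ ^ p else 0)) ^ (1 / p)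

/-- The norm `∑ (|z¹|^p + |z²|^p + 2 |z³|^p)^(1/p)` of a field of symmetric matrices with diagonal
entries `z¹`, `z²` and off-diagonal entry `z³`. -/
noncomputable def symNorm (p : ℝ) (N₁ N₂ : ℕ) (z₁ z₂ z₃ : ℕ → ℕ → U) : ℝ :=
  ∑ i ∈ Finset.range N₁, ∑ j ∈ Finset.range N₂,
    ((if 1 ≤ i ∧ i + 1 < N₁ then ‖z₁ i j‖ ^ p else 0)
      + (if 1 ≤ j ∧ j + 1 < N₂ then ‖z₂ i j‖ ^ p else 0)
      + 2 * (if (1 ≤ i ∧ i + 1 < N₁) ∧ (1 ≤ j ∧ j + 1 < N₂) then ‖z₃ i j‖ ^ p else 0)) ^ (1 / p)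

/-- `‖ℰ w‖₁` for the symmetrized gradient
`ℰ w = (δ_{x-} w¹, δ_{y-} w², (δ_{y-} w¹ + δ_{x-} w²) / 2)`. -/
noncomputable def symGradNorm (p : ℝ) (N₁ N₂ : ℕ) (w₁ w₂ : ℕ → ℕ → U) : ℝ :=
  symNorm p N₁ N₂ (bwdX w₁) (bwdY w₂) (fun i j => (2⁻¹ : ℝ) • (bwdY w₁ i j + bwdX w₂ i j))

/-- Discrete second-order TGV in a vector space:
the minimum over `w` of `α₁ ‖D u - w‖₁ + α₀ ‖ℰ w‖₁`. -/
noncomputable def vectorTGV (α₀ α₁ p : ℝ) (N₁ N₂ : ℕ) (u : ℕ → ℕ → U) : ℝ :=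
  ⨅ w : (ℕ → ℕ → U) × (ℕ → ℕ → U),
    α₁ * vecNorm p N₁ N₂ (fun i j => fwdX u i j - w.1 i j) (fun i j => fwdY u i j - w.2 i j)
      + α₀ * symGradNorm p N₁ N₂ w.1 w.2

/-- Discrete second-order total variation in a vector space: `‖ℰ D u‖₁`. -/
noncomputable def vectorTV2 (p : ℝ) (N₁ N₂ : ℕ) (u : ℕ → ℕ → U) : ℝ :=
  symGradNorm p N₁ N₂ (fwdX u) (fwdY u)

end VectorSpace

/-! ## Bivariate TGV for manifold-valued data

A tangent tuple `[x, y]` is the pair `(x, y)`. `D` measures the distance of two tangent tuples and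
`S` (that is, `D^sym`) takes four tangent tuples. -/

section ManifoldTGV

variable {M : Type*} [MetricSpace M]

/-- Total variation of a manifold-valued bivariate signal. -/
noncomputable def manifoldTV (p : ℝ) (N₁ N₂ : ℕ) (u : ℕ → ℕ → M) : ℝ :=
  ∑ i ∈ Finset.range N₁, ∑ j ∈ Finset.range N₂,
    ((if i + 1 < N₁ then dist (u (i + 1) j) (u i j) ^ p else 0)
      + (if j + 1 < N₂ then dist (u i (j + 1)) (u i j) ^ p else 0)) ^ (1 / p)

/-- The sum with weight `α₁` in the definition of M-TGV. -/
noncomputable def firstOrderCost (p : ℝ) (N₁ N₂ : ℕ) (u y₁ y₂ : ℕ → ℕ → M) : ℝ :=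
  ∑ i ∈ Finset.range N₁, ∑ j ∈ Finset.range N₂,
    ((if i + 1 < N₁ then dist (u (i + 1) j) (y₁ i j) ^ p else 0)
      + (if j + 1 < N₂ then dist (u i (j + 1)) (y₂ i j) ^ p else 0)) ^ (1 / p)

/-- The sum with weight `α₀` in the definition of M-TGV. -/
noncomputable def secondOrderCost (D : M × M → M × M → ℝ≥0)
    (S : M × M → M × M → M × M → M × M → ℝ≥0) (p : ℝ) (N₁ N₂ : ℕ) (u y₁ y₂ : ℕ → ℕ → M) : ℝ :=
  ∑ i ∈ Finset.range N₁, ∑ j ∈ Finset.range N₂,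
    ((if 1 ≤ i ∧ i + 1 < N₁ then
        (D (u i j, y₁ i j) (u (i - 1) j, y₁ (i - 1) j) : ℝ) ^ p else 0)
      + (if 1 ≤ j ∧ j + 1 < N₂ then
        (D (u i j, y₂ i j) (u i (j - 1), y₂ i (j - 1)) : ℝ) ^ p else 0)
      + (2 : ℝ) ^ (1 - p) * (if (1 ≤ i ∧ i + 1 < N₁) ∧ (1 ≤ j ∧ j + 1 < N₂) then
        (S (u i j, y₁ i j) (u i j, y₂ i j) (u i (j - 1), y₁ i (j - 1))
          (u (i - 1) j, y₂ (i - 1) j) : ℝ) ^ p else 0)) ^ (1 / p)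

/-- The functional of `(y¹, y²)` that is minimized in the definition of M-TGV. -/
noncomputable def mtgvCost (D : M × M → M × M → ℝ≥0)
    (S : M × M → M × M → M × M → M × M → ℝ≥0) (α₀ α₁ p : ℝ) (N₁ N₂ : ℕ)
    (u y₁ y₂ : ℕ → ℕ → M) : ℝ :=
  α₁ * firstOrderCost p N₁ N₂ u y₁ y₂ + α₀ * secondOrderCost D S p N₁ N₂ u y₁ y₂

/-- The minimum in the definition of M-TGV of `u` is attained at `(y¹, y²)`. -/
def IsMTGVMinimizer (D : M × M → M × M → ℝ≥0)
    (S : M × M → M × M → M × M → M × M → ℝ≥0) (α₀ α₁ p : ℝ) (N₁ N₂ : ℕ)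
    (u y₁ y₂ : ℕ → ℕ → M) : Prop :=
  ∀ z₁ z₂ : ℕ → ℕ → M, mtgvCost D S α₀ α₁ p N₁ N₂ u y₁ y₂ ≤ mtgvCost D S α₀ α₁ p N₁ N₂ u z₁ z₂

/-- The value of bivariate M-TGV at `u` (the infimum of the costs, hence the minimum if it is
attained). -/
noncomputable def MTGV (D : M × M → M × M → ℝ≥0)
    (S : M × M → M × M → M × M → M × M → ℝ≥0) (α₀ α₁ p : ℝ) (N₁ N₂ : ℕ)
    (u : ℕ → ℕ → M) : ℝ :=
  ⨅ y : (ℕ → ℕ → M) × (ℕ → ℕ → M), mtgvCost D S α₀ α₁ p N₁ N₂ u y.1 y.2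

/-- The second-order total variation induced by `D` and `S`: the second-order part of the M-TGV
cost for the tangent tuples `[u_{i,j}, u_{i+1,j}]` and `[u_{i,j}, u_{i,j+1}]`. -/
noncomputable def manifoldTV2 (D : M × M → M × M → ℝ≥0)
    (S : M × M → M × M → M × M → M × M → ℝ≥0) (p : ℝ) (N₁ N₂ : ℕ) (u : ℕ → ℕ → M) : ℝ :=
  secondOrderCost D S p N₁ N₂ u (fun i j => u (i + 1) j) (fun i j => u i (j + 1))

end ManifoldTGV

/-! The cost is a positive combination of finite sums of nonnegative terms, so it vanishes exactly
when every term does. A zero first-order part forces the tuples to be the gradient tuples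
$[u_{i,j},u_{i+1,j}]$, $[u_{i,j},u_{i,j+1}]$; a zero second-order part then says that `D` vanishes
on all three-point windows of rows and columns and that `S` vanishes on all three-by-three windows.
For a locally geodesic signal the gradient tuples thus have cost zero and are minimal.

Conversely, a minimizer of cost zero makes rows and columns locally geodesic through `D`, and then
the antidiagonals through `S`. The passage from local to global,
`IsLocallyGeodesicSeq.isGeodesicSeq`, glues geodesics: two consecutive three-point windows share a
segment, on which their geodesics agree by uniqueness of the minimizing geodesic.

In a vector space, $w=y-u$ is a bijective change of variables that turns the cost into the TGV
functional. Attainment is the direct method (`exists_isMTGVMinimizer_of_continuous`): the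
first-order part confines the relevant competitors to a compact set. -/

section GeodesicLemmas

/-! ### Translating and gluing geodesics -/

open Filter Topology

variable {m : ℕ} {M : Type*} [MetricSpace M] [ChartedSpace (EuclideanSpace ℝ (Fin m)) M]
  [Bundle.RiemannianBundle (fun x : M => TangentSpace (𝓡 m) x)]

theorem HasZeroAcceleration.of_eventuallyEq_shift {γ γ' : ℝ → M} {t c : ℝ}
    (hγ : HasZeroAcceleration m γ' (t + c)) (h : γ =ᶠ[𝓝 t] fun s => γ' (s + c)) :
    HasZeroAcceleration m γ t := by
  have h0 : γ t = γ' (t + c) := h.eq_of_nhds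
  unfold HasZeroAcceleration at hγ ⊢
  intro x z
  set x' : ℝ → EuclideanSpace ℝ (Fin m) :=
    fun s => chartAt (EuclideanSpace ℝ (Fin m)) (γ' (t + c)) (γ' s) with hx'
  -- Since `γ t = γ' (t + c)`, both curves are read in the same chart, so the coordinate curves are
  -- translates of each other near `t`.
  have hx : x =ᶠ[𝓝 t] fun s => x' (s + c) := by
    filter_upwards [h] with s hs
    simp only [x, x', hs, h0]
  have hd : deriv x =ᶠ[𝓝 t] fun s => deriv x' (s + c) := by
    filter_upwards [hx.deriv] with s hs
    rw [hs, deriv_comp_add_const]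
  have hdd : deriv (deriv x) t = deriv (deriv x') (t + c) := by
    rw [hd.deriv_eq, deriv_comp_add_const]
  rw [hdd, hd.eq_of_nhds, hx.eq_of_nhds, h0]
  exact hγ z

theorem norm_mfderiv_of_eventuallyEq_shift {γ γ' : ℝ → M} {t c : ℝ}
    (hγ' : MDifferentiableAt 𝓘(ℝ, ℝ) (𝓡 m) γ' (t + c))
    (h : γ =ᶠ[𝓝 t] fun s => γ' (s + c)) :
    ‖mfderiv 𝓘(ℝ, ℝ) (𝓡 m) γ t (1 : ℝ)‖ = ‖mfderiv 𝓘(ℝ, ℝ) (𝓡 m) γ' (t + c) (1 : ℝ)‖ := by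
  have h0 : γ t = γ' (t + c) := h.eq_of_nhds
  -- The two velocities lie in fibres over points that are only propositionally equal. All fibres
  -- share the same underlying coordinate space, so the base point can be substituted inside the
  -- norm.
  have hnorm : ∀ (q q' : M) (v : EuclideanSpace ℝ (Fin m)), q = q' →
      ‖(show TangentSpace (𝓡 m) q from v)‖ = ‖(show TangentSpace (𝓡 m) q' from v)‖ := by
    rintro q q' v rfl
    rfl
  have hs : HasMFDerivAt 𝓘(ℝ, ℝ) 𝓘(ℝ, ℝ) (fun s : ℝ => s + c) t (ContinuousLinearMap.id ℝ ℝ) :=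
    ((hasFDerivAt_id t).add_const c).hasMFDerivAt
  have hcomp := (hγ'.hasMFDerivAt.comp t hs).congr_of_eventuallyEq h
  rw [hcomp.mfderiv]
  exact hnorm _ _ _ h0

/-- Smoothness, acceleration and speed depend only on the germ of the curve. Neighbourhoods are
taken within `[0, L]` so that the endpoints are covered as well. -/
theorem IsUnitSpeedGeodesic.of_locally_eq {γ : ℝ → M} {L : ℝ} (hL : 0 ≤ L)
    (h : ∀ t ∈ Set.Icc 0 L, ∃ (γ' : ℝ → M) (L' c : ℝ), IsUnitSpeedGeodesic m γ' L' ∧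
      ∀ᶠ s in 𝓝[Set.Icc 0 L] t, s + c ∈ Set.Icc 0 L' ∧ γ s = γ' (s + c)) :
    IsUnitSpeedGeodesic m γ L := by
  refine ⟨hL, fun t ht => ?_, fun t ht => ?_⟩
  · obtain ⟨γ', L', c, hγ', hev⟩ := h t ht
    obtain ⟨U, hU, hUs⟩ := (eventually_nhdsWithin_iff.1 hev).exists_mem
    have htU : t ∈ U := mem_of_mem_nhds hU
    have hshift : ContMDiffWithinAt 𝓘(ℝ, ℝ) 𝓘(ℝ, ℝ) ∞ (fun s : ℝ => s + c)
        (Set.Icc 0 L ∩ U) t :=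
      (contDiff_id.add contDiff_const).contMDiff.contMDiffAt.contMDiffWithinAt
    have hmaps : Set.MapsTo (fun s : ℝ => s + c) (Set.Icc 0 L ∩ U) (Set.Icc 0 L') :=
      fun s hs => (hUs s hs.2 hs.1).1
    have hcomp := (hγ'.2.1 (t + c) (hUs t htU ht).1).comp t hshift hmaps
    refine (contMDiffWithinAt_inter hU).1 (hcomp.congr (fun s hs => ?_) ?_)
    · exact (hUs s hs.2 hs.1).2
    · exact (hUs t htU ht).2
  · obtain ⟨γ', L', c, hγ', hev⟩ := h t (Set.Ioo_subset_Icc_self ht)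
    rw [nhdsWithin_eq_nhds.2 (Icc_mem_nhds ht.1 ht.2)] at hev
    -- A whole neighbourhood of `t + c` lies in `[0, L']`, so `t + c` is interior, where the
    -- geodesic equation for `γ'` is available.
    have htc : t + c ∈ Set.Ioo 0 L' := by
      rw [← interior_Icc, mem_interior_iff_mem_nhds]
      have h1 : Tendsto (fun s : ℝ => s - c) (𝓝 (t + c)) (𝓝 t) := by
        have : ContinuousAt (fun s : ℝ => s - c) (t + c) := by fun_prop
        simpa [ContinuousAt] using this
      filter_upwards [h1.eventually hev] with s hs
      simpa using hs.1
    have heq : γ =ᶠ[𝓝 t] fun s => γ' (s + c) := hev.mono fun s hs => hs.2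
    have hdiff : MDifferentiableAt 𝓘(ℝ, ℝ) (𝓡 m) γ' (t + c) :=
      ((hγ'.2.1 _ (Set.Ioo_subset_Icc_self htc)).contMDiffAt
        (Icc_mem_nhds htc.1 htc.2)).mdifferentiableAt (by simp)
    refine ⟨(hγ'.2.2 _ htc).1.of_eventuallyEq_shift heq, ?_⟩
    rw [norm_mfderiv_of_eventuallyEq_shift hdiff heq]
    exact (hγ'.2.2 _ htc).2

theorem IsUnitSpeedGeodesic.shift {γ : ℝ → M} {L : ℝ} (h : IsUnitSpeedGeodesic m γ L)
    {c ℓ : ℝ} (hc : 0 ≤ c) (hℓ : 0 ≤ ℓ) (hcℓ : ℓ + c ≤ L) :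
    IsUnitSpeedGeodesic m (fun s => γ (s + c)) ℓ :=
  .of_locally_eq hℓ fun t _ => ⟨γ, L, c, h, eventually_nhdsWithin_of_forall fun s hs =>
    ⟨⟨by linarith [hs.1], by linarith [hs.2]⟩, rfl⟩⟩

theorem isUnitSpeedGeodesic_const (a : M) : IsUnitSpeedGeodesic m (fun _ => a) 0 :=
  ⟨le_rfl, contMDiffOn_const, by simp⟩

theorem IsGeodesicSeq.congr {n : ℕ} {u v : ℕ → M} (h : IsGeodesicSeq m n u)
    (huv : ∀ i ≤ n, u i = v i) : IsGeodesicSeq m n v := by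
  obtain ⟨L, γ, hγ, hu, hd⟩ := h
  refine ⟨L, γ, hγ, fun i hi => (hu i hi).trans (huv i hi), fun i hi => ?_⟩
  rw [← huv i hi.le, ← huv (i + 1) hi, hd i hi]

theorem isGeodesicSeq_zero (u : ℕ → M) : IsGeodesicSeq m 0 u :=
  ⟨0, fun _ => u 0, isUnitSpeedGeodesic_const _, by simp, by simp⟩

theorem UniqueGeodesic.isGeodesicSeq_one {u : ℕ → M} (h : UniqueGeodesic m (u 0) (u 1)) :
    IsGeodesicSeq m 1 u := by
  obtain ⟨γ, ⟨hγ, h0, h1⟩, -⟩ := h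
  refine ⟨dist (u 0) (u 1), γ, hγ, fun i hi => ?_, fun i hi => ?_⟩
  · interval_cases i <;> simp [h0, h1]
  · interval_cases i
    simp

/-- A geodesic sequence, described by its step length. -/
theorem isGeodesicSeq_iff_step {n : ℕ} (hn : 0 < n) {u : ℕ → M} :
    IsGeodesicSeq m n u ↔ ∃ (ℓ : ℝ) (γ : ℝ → M), IsUnitSpeedGeodesic m γ (n * ℓ) ∧
      (∀ i ≤ n, γ (i * ℓ) = u i) ∧ ∀ i < n, dist (u i) (u (i + 1)) = ℓ := by
  have hn' : (n : ℝ) ≠ 0 := by positivity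
  constructor
  · rintro ⟨L, γ, hγ, hu, hd⟩
    refine ⟨L / n, γ, by rwa [mul_div_cancel₀ _ hn'], fun i hi => ?_, hd⟩
    rw [← hu i hi, mul_div_assoc]
  · rintro ⟨ℓ, γ, hγ, hu, hd⟩
    refine ⟨n * ℓ, γ, hγ, fun i hi => ?_, fun i hi => ?_⟩
    · rw [← hu i hi]
      congr 1
      field_simp
    · rw [hd i hi]
      field_simp

/-- The geodesic through `u 0, …, u (n + 1)` and the one through the last three points both minimize
length between `u n` and `u (n + 1)`. By uniqueness they agree on that segment, so following the
first and then the second gives a geodesic. -/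
theorem IsGeodesicSeq.succ {n : ℕ} {u : ℕ → M} (h : IsGeodesicSeq m (n + 1) u)
    (h2 : IsGeodesicSeq m 2 (fun k => u (n + k))) (huniq : UniqueGeodesic m (u n) (u (n + 1))) :
    IsGeodesicSeq m (n + 2) u := by
  obtain ⟨ℓ, γ, hγ, hu, hd⟩ := (isGeodesicSeq_iff_step n.succ_pos).1 h
  obtain ⟨ℓ', δ, hδ, hv, hd'⟩ := (isGeodesicSeq_iff_step two_pos).1 h2
  have hdn : dist (u n) (u (n + 1)) = ℓ := hd n n.lt_succ_self
  have hℓ' : ℓ' = ℓ := by rw [← hd' 0 two_pos, ← hdn]; rfl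
  subst hℓ'
  have hdall : ∀ i < n + 2, dist (u i) (u (i + 1)) = ℓ' := by
    intro i hi
    rcases Nat.lt_succ_iff_lt_or_eq.1 hi with hi | rfl
    · exact hd i hi
    · exact hd' 1 one_lt_two
  refine (isGeodesicSeq_iff_step (by omega)).2 ?_
  have hℓ0 : 0 ≤ ℓ' := hdn ▸ dist_nonneg
  -- With step length zero the common segment has no interior and cannot be used for gluing, but
  -- then all points coincide.
  rcases hℓ0.eq_or_lt with h0 | hpos
  · subst h0
    have hconst : ∀ i ≤ n + 2, u i = u 0 := by
      intro i
      induction i with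
      | zero => simp
      | succ i ih =>
        intro hi
        rw [← ih (by omega), ← dist_eq_zero.1 (hdall i (by omega))]
    exact ⟨0, fun _ => u 0, by simpa using isUnitSpeedGeodesic_const (u 0),
      fun i hi => (hconst i hi).symm, hdall⟩
  have hoverlap : ∀ s ∈ Set.Icc 0 ℓ', γ (s + n * ℓ') = δ s := by
    obtain ⟨η, -, hη⟩ := huniq
    rw [hdn] at hη
    have h1 : IsMinimizingGeodesic m (fun s => γ (s + n * ℓ')) (u n) (u (n + 1)) := by
      refine ⟨?_, ?_, ?_⟩
      · rw [hdn]
        exact hγ.shift (by positivity) hℓ0 (by push_cast; linarith)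
      · simpa using hu n n.le_succ
      · rw [hdn, ← hu (n + 1) le_rfl, Nat.cast_succ, add_one_mul, add_comm]
    have h2 : IsMinimizingGeodesic m δ (u n) (u (n + 1)) := by
      refine ⟨?_, ?_, ?_⟩
      · rw [hdn]
        simpa using hδ.shift le_rfl hℓ0 (by push_cast; linarith)
      · simpa using hv 0 (by simp)
      · simpa [hdn] using hv 1 (by simp)
    exact fun s hs => (hη _ h1 hs).trans (hη _ h2 hs).symm
  have hγδ : ∀ t : ℝ, n * ℓ' ≤ t →
      (if t ≤ (n + 1) * ℓ' then γ t else δ (t - n * ℓ')) = δ (t - n * ℓ') := by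
    intro t ht
    split_ifs with h
    · rw [← hoverlap (t - n * ℓ') ⟨by linarith, by linarith⟩]
      simp
    · rfl
  refine ⟨ℓ', fun t => if t ≤ (n + 1) * ℓ' then γ t else δ (t - n * ℓ'),
    .of_locally_eq (by positivity) fun t _ => ?_, fun i hi => ?_, hdall⟩
  -- The switch happens at the right end of the overlap. Before it the curve is locally `γ`; from it
  -- on, `t` exceeds `n * ℓ'` because the step is positive, so the curve is locally a translate of
  -- `δ`.
  · by_cases ht : t < (n + 1) * ℓ'
    · refine ⟨γ, _, 0, hγ, ?_⟩
      filter_upwards [self_mem_nhdsWithin, mem_nhdsWithin_of_mem_nhds (Iio_mem_nhds ht)]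
        with s hs hs'
      have hs'' : s ≤ (n + 1) * ℓ' := le_of_lt hs'
      refine ⟨⟨by simpa using hs.1, by push_cast; simpa using hs''⟩, by simp [hs'']⟩
    · have ht' : n * ℓ' < t := by linarith
      refine ⟨δ, _, -(n * ℓ'), hδ, ?_⟩
      filter_upwards [self_mem_nhdsWithin, mem_nhdsWithin_of_mem_nhds (Ioi_mem_nhds ht')]
        with s hs hs'
      have hs1 := hs.2
      have hs2 : n * ℓ' < s := hs'
      push_cast at hs1 ⊢
      exact ⟨⟨by linarith, by linarith⟩, by rw [hγδ s hs2.le, sub_eq_add_neg]⟩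
  · rcases Nat.lt_succ_iff_lt_or_eq.1 (Nat.lt_succ_of_le hi) with hi | rfl
    · have : (i : ℝ) * ℓ' ≤ (n + 1) * ℓ' := by
        gcongr
        exact_mod_cast Nat.lt_succ_iff.1 hi
      simp only [if_pos this]
      exact hu i (Nat.lt_succ_iff.1 hi)
    · dsimp only
      rw [hγδ _ (by push_cast; linarith), ← hv 2 le_rfl]
      congr 1
      push_cast; ring

/-- Induction appending one point at a time. For two points there is no three-point window, and the
geodesic comes from the existence part of `UniqueGeodesic`. -/
theorem IsLocallyGeodesicSeq.isGeodesicSeq {n : ℕ} {u : ℕ → M} (h : IsLocallyGeodesicSeq m n u)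
    (huniq : ∀ i < n, UniqueGeodesic m (u i) (u (i + 1))) : IsGeodesicSeq m n u := by
  induction n with
  | zero => exact isGeodesicSeq_zero u
  | succ n ih =>
    rcases n with _ | n
    · exact (huniq 0 one_pos).isGeodesicSeq_one
    · exact (ih (fun i hi => h i (by omega)) fun i hi => huniq i (by omega)).succ
        (h n le_rfl) (huniq n (by omega))

end GeodesicLemmas

/-! ### The cost functional: vanishing, coercivity and existence of minimizers -/

section TGVLemmas

open Filter Topology

variable {M : Type*} [MetricSpace M] {D : M × M → M × M → ℝ≥0}
  {S : M × M → M × M → M × M → M × M → ℝ≥0} {α₀ α₁ p : ℝ} {N₁ N₂ : ℕ}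

theorem sum_grid_eq_zero_iff {f : ℕ → ℕ → ℝ} (hf : ∀ i j, 0 ≤ f i j) :
    ∑ i ∈ Finset.range N₁, ∑ j ∈ Finset.range N₂, f i j = 0 ↔
      ∀ i < N₁, ∀ j < N₂, f i j = 0 := by
  rw [Finset.sum_eq_zero_iff_of_nonneg fun i _ => Finset.sum_nonneg fun j _ => hf i j]
  simp only [Finset.sum_eq_zero_iff_of_nonneg fun j _ => hf _ j, Finset.mem_range]

theorem ite_rpow_nonneg (c : Prop) [Decidable c] {a : ℝ} (ha : 0 ≤ a) (p : ℝ) :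
    0 ≤ if c then a ^ p else 0 := by
  split_ifs
  · positivity
  · rfl

theorem firstOrderCost_nonneg (p : ℝ) (N₁ N₂ : ℕ) (u y₁ y₂ : ℕ → ℕ → M) :
    0 ≤ firstOrderCost p N₁ N₂ u y₁ y₂ :=
  Finset.sum_nonneg fun _ _ => Finset.sum_nonneg fun _ _ => Real.rpow_nonneg
    (add_nonneg (ite_rpow_nonneg _ dist_nonneg p) (ite_rpow_nonneg _ dist_nonneg p)) _

theorem secondOrderCost_summand_nonneg {M : Type*} (D : M × M → M × M → ℝ≥0)
    (S : M × M → M × M → M × M → M × M → ℝ≥0) (p : ℝ) (N₁ N₂ : ℕ) (u y₁ y₂ : ℕ → ℕ → M)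
    (i j : ℕ) :
    0 ≤ (if 1 ≤ i ∧ i + 1 < N₁ then
        (D (u i j, y₁ i j) (u (i - 1) j, y₁ (i - 1) j) : ℝ) ^ p else 0)
      + (if 1 ≤ j ∧ j + 1 < N₂ then
        (D (u i j, y₂ i j) (u i (j - 1), y₂ i (j - 1)) : ℝ) ^ p else 0)
      + (2 : ℝ) ^ (1 - p) * (if (1 ≤ i ∧ i + 1 < N₁) ∧ (1 ≤ j ∧ j + 1 < N₂) then
        (S (u i j, y₁ i j) (u i j, y₂ i j) (u i (j - 1), y₁ i (j - 1))
          (u (i - 1) j, y₂ (i - 1) j) : ℝ) ^ p else 0) :=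
  add_nonneg (add_nonneg (ite_rpow_nonneg _ (NNReal.coe_nonneg _) p)
      (ite_rpow_nonneg _ (NNReal.coe_nonneg _) p))
    (mul_nonneg (by positivity) (ite_rpow_nonneg _ (NNReal.coe_nonneg _) p))

theorem secondOrderCost_nonneg {M : Type*} (D : M × M → M × M → ℝ≥0)
    (S : M × M → M × M → M × M → M × M → ℝ≥0) (p : ℝ) (N₁ N₂ : ℕ) (u y₁ y₂ : ℕ → ℕ → M) :
    0 ≤ secondOrderCost D S p N₁ N₂ u y₁ y₂ :=
  Finset.sum_nonneg fun _ _ => Finset.sum_nonneg fun _ _ => Real.rpow_nonneg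
    (secondOrderCost_summand_nonneg D S p N₁ N₂ u y₁ y₂ _ _) _

theorem ite_rpow_eq_zero_iff {c : Prop} [Decidable c] {a : ℝ} (ha : 0 ≤ a) (hp : p ≠ 0) :
    (if c then a ^ p else 0) = 0 ↔ (c → a = 0) := by
  simp [Real.rpow_eq_zero ha hp]

theorem firstOrderCost_eq_zero_iff (hp : 0 < p) {u y₁ y₂ : ℕ → ℕ → M} :
    firstOrderCost p N₁ N₂ u y₁ y₂ = 0 ↔ ∀ i < N₁, ∀ j < N₂,
      (i + 1 < N₁ → y₁ i j = u (i + 1) j) ∧ (j + 1 < N₂ → y₂ i j = u i (j + 1)) := by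
  have h1 := fun i j => ite_rpow_nonneg (i + 1 < N₁)
    (dist_nonneg (x := u (i + 1) j) (y := y₁ i j)) p
  have h2 := fun i j => ite_rpow_nonneg (j + 1 < N₂)
    (dist_nonneg (x := u i (j + 1)) (y := y₂ i j)) p
  unfold firstOrderCost
  rw [sum_grid_eq_zero_iff fun i j => Real.rpow_nonneg (add_nonneg (h1 i j) (h2 i j)) _]
  refine forall₄_congr fun i _ j _ => ?_
  rw [Real.rpow_eq_zero (add_nonneg (h1 i j) (h2 i j)) (one_div_pos.2 hp).ne',
    add_eq_zero_iff_of_nonneg (h1 i j) (h2 i j), ite_rpow_eq_zero_iff dist_nonneg hp.ne',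
    ite_rpow_eq_zero_iff dist_nonneg hp.ne', dist_eq_zero, dist_eq_zero,
    eq_comm (a := u (i + 1) j), eq_comm (a := u i (j + 1))]

theorem secondOrderCost_eq_zero_iff {M : Type*} {D : M × M → M × M → ℝ≥0}
    {S : M × M → M × M → M × M → M × M → ℝ≥0} (hp : 0 < p) {u y₁ y₂ : ℕ → ℕ → M} :
    secondOrderCost D S p N₁ N₂ u y₁ y₂ = 0 ↔ ∀ i < N₁, ∀ j < N₂,
      (1 ≤ i ∧ i + 1 < N₁ → D (u i j, y₁ i j) (u (i - 1) j, y₁ (i - 1) j) = 0) ∧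
      (1 ≤ j ∧ j + 1 < N₂ → D (u i j, y₂ i j) (u i (j - 1), y₂ i (j - 1)) = 0) ∧
      ((1 ≤ i ∧ i + 1 < N₁) ∧ (1 ≤ j ∧ j + 1 < N₂) →
        S (u i j, y₁ i j) (u i j, y₂ i j) (u i (j - 1), y₁ i (j - 1))
          (u (i - 1) j, y₂ (i - 1) j) = 0) := by
  have h := secondOrderCost_summand_nonneg D S p N₁ N₂ u y₁ y₂
  unfold secondOrderCost
  rw [sum_grid_eq_zero_iff fun i j => Real.rpow_nonneg (h i j) _]
  refine forall₄_congr fun i _ j _ => ?_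
  rw [Real.rpow_eq_zero (h i j) (one_div_pos.2 hp).ne',
    add_eq_zero_iff_of_nonneg
      (add_nonneg (ite_rpow_nonneg _ (NNReal.coe_nonneg _) p)
        (ite_rpow_nonneg _ (NNReal.coe_nonneg _) p))
      (mul_nonneg (by positivity) (ite_rpow_nonneg _ (NNReal.coe_nonneg _) p)),
    add_eq_zero_iff_of_nonneg (ite_rpow_nonneg _ (NNReal.coe_nonneg _) p)
        (ite_rpow_nonneg _ (NNReal.coe_nonneg _) p),
    mul_eq_zero_iff_left (by positivity),
    ite_rpow_eq_zero_iff (NNReal.coe_nonneg _) hp.ne',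
    ite_rpow_eq_zero_iff (NNReal.coe_nonneg _) hp.ne',
    ite_rpow_eq_zero_iff (NNReal.coe_nonneg _) hp.ne',
    NNReal.coe_eq_zero, NNReal.coe_eq_zero, NNReal.coe_eq_zero, and_assoc]

theorem firstOrderCost_gradient (hp : 0 < p) (N₁ N₂ : ℕ) (u : ℕ → ℕ → M) :
    firstOrderCost p N₁ N₂ u (fun i j => u (i + 1) j) (fun i j => u i (j + 1)) = 0 :=
  (firstOrderCost_eq_zero_iff hp).2 fun _ _ _ _ => ⟨fun _ => rfl, fun _ => rfl⟩

theorem mtgvCost_nonneg (hα₀ : 0 ≤ α₀) (hα₁ : 0 ≤ α₁) (u y₁ y₂ : ℕ → ℕ → M) :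
    0 ≤ mtgvCost D S α₀ α₁ p N₁ N₂ u y₁ y₂ :=
  add_nonneg (mul_nonneg hα₁ (firstOrderCost_nonneg ..))
    (mul_nonneg hα₀ (secondOrderCost_nonneg ..))

theorem mtgvCost_eq_zero_iff (hα₀ : 0 < α₀) (hα₁ : 0 < α₁) {u y₁ y₂ : ℕ → ℕ → M} :
    mtgvCost D S α₀ α₁ p N₁ N₂ u y₁ y₂ = 0 ↔
      firstOrderCost p N₁ N₂ u y₁ y₂ = 0 ∧ secondOrderCost D S p N₁ N₂ u y₁ y₂ = 0 := by
  unfold mtgvCost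
  rw [add_eq_zero_iff_of_nonneg (mul_nonneg hα₁.le (firstOrderCost_nonneg ..))
    (mul_nonneg hα₀.le (secondOrderCost_nonneg ..)), mul_eq_zero_iff_left hα₁.ne',
    mul_eq_zero_iff_left hα₀.ne']

theorem IsMTGVMinimizer.mtgv_eq {u y₁ y₂ : ℕ → ℕ → M}
    (h : IsMTGVMinimizer D S α₀ α₁ p N₁ N₂ u y₁ y₂) :
    MTGV D S α₀ α₁ p N₁ N₂ u = mtgvCost D S α₀ α₁ p N₁ N₂ u y₁ y₂ := by
  have : Nonempty ((ℕ → ℕ → M) × (ℕ → ℕ → M)) := ⟨(y₁, y₂)⟩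
  refine le_antisymm (ciInf_le ⟨mtgvCost D S α₀ α₁ p N₁ N₂ u y₁ y₂, ?_⟩ (y₁, y₂))
    (le_ciInf fun z => h z.1 z.2)
  rintro _ ⟨z, rfl⟩
  exact h z.1 z.2

/-- Coercivity: an entry is at most the $\ell^p$ norm of its pair, which is one summand of a
nonnegative sum. -/
theorem dist_le_firstOrderCost_left (hp : 0 < p) (u y₁ y₂ : ℕ → ℕ → M) {i j : ℕ}
    (hi : i + 1 < N₁) (hj : j < N₂) :
    dist (u (i + 1) j) (y₁ i j) ≤ firstOrderCost p N₁ N₂ u y₁ y₂ := by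
  have h1 := fun i j => ite_rpow_nonneg (i + 1 < N₁)
    (dist_nonneg (x := u (i + 1) j) (y := y₁ i j)) p
  have h2 := fun i j => ite_rpow_nonneg (j + 1 < N₂)
    (dist_nonneg (x := u i (j + 1)) (y := y₂ i j)) p
  have h3 := fun i j => Real.rpow_nonneg (add_nonneg (h1 i j) (h2 i j)) (1 / p)
  calc dist (u (i + 1) j) (y₁ i j)
      = (if i + 1 < N₁ then dist (u (i + 1) j) (y₁ i j) ^ p else 0) ^ (1 / p) := by
        rw [if_pos hi, ← Real.rpow_mul dist_nonneg, mul_one_div_cancel hp.ne', Real.rpow_one]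
    _ ≤ _ := Real.rpow_le_rpow (h1 i j) (le_add_of_nonneg_right (h2 i j)) (by positivity)
    _ ≤ _ := Finset.single_le_sum (f := fun j =>
        ((if i + 1 < N₁ then dist (u (i + 1) j) (y₁ i j) ^ p else 0)
          + (if j + 1 < N₂ then dist (u i (j + 1)) (y₂ i j) ^ p else 0)) ^ (1 / p))
        (fun j _ => h3 i j) (Finset.mem_range.2 hj)
    _ ≤ _ := Finset.single_le_sum (f := fun i => ∑ j ∈ Finset.range N₂,
        ((if i + 1 < N₁ then dist (u (i + 1) j) (y₁ i j) ^ p else 0)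
          + (if j + 1 < N₂ then dist (u i (j + 1)) (y₂ i j) ^ p else 0)) ^ (1 / p))
        (fun i _ => Finset.sum_nonneg fun j _ => h3 i j)
        (Finset.mem_range.2 (i.lt_succ_self.trans hi))

theorem firstOrderCost_transpose (p : ℝ) (N₁ N₂ : ℕ) (u y₁ y₂ : ℕ → ℕ → M) :
    firstOrderCost p N₂ N₁ (fun i j => u j i) (fun i j => y₂ j i) (fun i j => y₁ j i) =
      firstOrderCost p N₁ N₂ u y₁ y₂ := by
  unfold firstOrderCost
  rw [Finset.sum_comm]
  simp only [add_comm]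

theorem dist_le_firstOrderCost_right (hp : 0 < p) (u y₁ y₂ : ℕ → ℕ → M) {i j : ℕ}
    (hi : i < N₁) (hj : j + 1 < N₂) :
    dist (u i (j + 1)) (y₂ i j) ≤ firstOrderCost p N₁ N₂ u y₁ y₂ := by
  rw [← firstOrderCost_transpose]
  exact dist_le_firstOrderCost_left hp (fun i j => u j i)
    (fun i j => y₂ j i) (fun i j => y₁ j i) hj hi

/-- The cost depends only on the values on the grid. -/
theorem mtgvCost_congr {u y₁ y₂ z₁ z₂ : ℕ → ℕ → M}
    (h₁ : ∀ i j, i + 1 < N₁ → j < N₂ → y₁ i j = z₁ i j)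
    (h₂ : ∀ i j, i < N₁ → j + 1 < N₂ → y₂ i j = z₂ i j) :
    mtgvCost D S α₀ α₁ p N₁ N₂ u y₁ y₂ = mtgvCost D S α₀ α₁ p N₁ N₂ u z₁ z₂ := by
  unfold mtgvCost firstOrderCost secondOrderCost
  congr 2
  · refine Finset.sum_congr rfl fun i hi => Finset.sum_congr rfl fun j hj => ?_
    rw [Finset.mem_range] at hi hj
    congr 2
    · exact if_ctx_congr Iff.rfl (fun h => by rw [h₁ i j h hj]) fun _ => rfl
    · exact if_ctx_congr Iff.rfl (fun h => by rw [h₂ i j hi h]) fun _ => rfl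
  · refine Finset.sum_congr rfl fun i hi => Finset.sum_congr rfl fun j hj => ?_
    rw [Finset.mem_range] at hi hj
    congr 2
    · congr 1
      · exact if_ctx_congr Iff.rfl
          (fun h => by rw [h₁ i j h.2 hj, h₁ (i - 1) j (by omega) hj]) fun _ => rfl
      · exact if_ctx_congr Iff.rfl
          (fun h => by rw [h₂ i j hi h.2, h₂ i (j - 1) hi (by omega)]) fun _ => rfl
    · congr 1
      exact if_ctx_congr Iff.rfl
          (fun h => by rw [h₁ i j h.1.2 hj, h₂ i j hi h.2.2, h₁ i (j - 1) h.1.2 (by omega),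
            h₂ (i - 1) j (by omega) h.2.2]) fun _ => rfl

/-- Direct method in the product topology. Entries off the grid are unbounded but do not affect the
cost, so they may be reset to bring a competitor into a product of balls, compact by Tychonoff's
theorem. -/
theorem exists_isMTGVMinimizer_of_continuous [ProperSpace M] (hp : 0 < p) (hα₀ : 0 ≤ α₀)
    (hα₁ : 0 < α₁) (u : ℕ → ℕ → M)
    (hcont : Continuous fun y : (ℕ → ℕ → M) × (ℕ → ℕ → M) =>
      mtgvCost D S α₀ α₁ p N₁ N₂ u y.1 y.2) :
    ∃ y₁ y₂, IsMTGVMinimizer D S α₀ α₁ p N₁ N₂ u y₁ y₂ := by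
  let K (R : ℝ) (b : ℕ → ℕ → M) : Set (ℕ → ℕ → M) :=
    Set.univ.pi fun i => Set.univ.pi fun j => Metric.closedBall (b i j) R
  have hK : ∀ R b, IsCompact (K R b) := fun R b =>
    isCompact_univ_pi fun i => isCompact_univ_pi fun j => isCompact_closedBall _ _
  have hKself : ∀ {R} b, 0 ≤ R → b ∈ K R b := fun b hR i _ j _ => Metric.mem_closedBall_self hR
  have hKproj : ∀ {R} (b z : ℕ → ℕ → M), 0 ≤ R → ∃ z' ∈ K R b, ∀ i j, dist (b i j) (z i j) ≤ R →
      z i j = z' i j := by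
    classical
    intro R b z hR
    refine ⟨fun i j => if dist (b i j) (z i j) ≤ R then z i j else b i j, fun i _ j _ => ?_,
      fun i j h => (if_pos h).symm⟩
    dsimp only
    split_ifs with h
    · rwa [Metric.mem_closedBall, dist_comm]
    · exact Metric.mem_closedBall_self hR
  clear_value K
  generalize hb₁ : (fun i j => u (i + 1) j) = b₁
  generalize hb₂ : (fun i j => u i (j + 1)) = b₂
  obtain ⟨C, hC⟩ : ∃ C, mtgvCost D S α₀ α₁ p N₁ N₂ u b₁ b₂ = C := ⟨_, rfl⟩
  -- `C` is the cost of the gradient tuples. A competitor of cost at most `C` has first-order cost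
  -- at most `C / α₁`, hence grid entries within that radius of `b₁`, `b₂`; any other competitor
  -- loses to `(b₁, b₂)` itself.
  have hR : 0 ≤ C / α₁ := div_nonneg (hC ▸ mtgvCost_nonneg hα₀ hα₁.le u b₁ b₂) hα₁.le
  obtain ⟨⟨y₁, y₂⟩, -, hmin⟩ := ((hK (C / α₁) b₁).prod (hK (C / α₁) b₂)).exists_isMinOn
    ⟨(b₁, b₂), hKself b₁ hR, hKself b₂ hR⟩ hcont.continuousOn
  have hmin' : ∀ z₁ ∈ K (C / α₁) b₁, ∀ z₂ ∈ K (C / α₁) b₂,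
      mtgvCost D S α₀ α₁ p N₁ N₂ u y₁ y₂ ≤ mtgvCost D S α₀ α₁ p N₁ N₂ u z₁ z₂ :=
    fun z₁ h₁ z₂ h₂ => isMinOn_iff.1 hmin (z₁, z₂) ⟨h₁, h₂⟩
  refine ⟨y₁, y₂, fun z₁ z₂ => ?_⟩
  rcases le_or_gt (mtgvCost D S α₀ α₁ p N₁ N₂ u z₁ z₂) C with hz | hz
  · have hfirst : firstOrderCost p N₁ N₂ u z₁ z₂ ≤ C / α₁ := by
      rw [le_div_iff₀' hα₁]
      exact (le_add_of_nonneg_right (mul_nonneg hα₀ (secondOrderCost_nonneg ..))).trans hz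
    obtain ⟨z₁', hz₁', h₁⟩ := hKproj b₁ z₁ hR
    obtain ⟨z₂', hz₂', h₂⟩ := hKproj b₂ z₂ hR
    have hcongr : mtgvCost D S α₀ α₁ p N₁ N₂ u z₁ z₂ = mtgvCost D S α₀ α₁ p N₁ N₂ u z₁' z₂' := by
      subst hb₁ hb₂
      exact mtgvCost_congr
        (fun i j hi hj => h₁ i j ((dist_le_firstOrderCost_left hp u z₁ z₂ hi hj).trans hfirst))
        (fun i j hi hj => h₂ i j ((dist_le_firstOrderCost_right hp u z₁ z₂ hi hj).trans hfirst))
    rw [hcongr]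
    exact hmin' _ hz₁' _ hz₂'
  · exact (hmin' _ (hKself b₁ hR) _ (hKself b₂ hR)).trans (hC.trans_le hz.le)

/-! ### The vector space case -/

section VectorValued

variable {U : Type*} [NormedAddCommGroup U] [NormedSpace ℝ U]

theorem continuous_symGradNorm (hp : 0 < p) (N₁ N₂ : ℕ) :
    Continuous fun w : (ℕ → ℕ → U) × (ℕ → ℕ → U) => symGradNorm p N₁ N₂ w.1 w.2 := by
  have hite : ∀ (c : Prop) [Decidable c] (f : (ℕ → ℕ → U) × (ℕ → ℕ → U) → U), Continuous f →
      Continuous fun w => if c then ‖f w‖ ^ p else 0 := by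
    intro c _ f hf
    split_ifs
    · exact hf.norm.rpow_const fun _ => Or.inr hp.le
    · exact continuous_const
  unfold symGradNorm symNorm bwdX bwdY
  refine continuous_finsetSum _ fun i _ => continuous_finsetSum _ fun j _ =>
    Continuous.rpow_const (((hite _ _ ?_).add (hite _ _ ?_)).add
      (continuous_const.mul (hite _ _ ?_))) fun _ => Or.inr (by positivity)
  all_goals fun_prop

theorem continuous_firstOrderCost (hp : 0 < p) (N₁ N₂ : ℕ) (u : ℕ → ℕ → M) :
    Continuous fun y : (ℕ → ℕ → M) × (ℕ → ℕ → M) => firstOrderCost p N₁ N₂ u y.1 y.2 := by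
  have hite : ∀ (c : Prop) [Decidable c] (f : (ℕ → ℕ → M) × (ℕ → ℕ → M) → ℝ), Continuous f →
      Continuous fun w => if c then f w ^ p else 0 := by
    intro c _ f hf
    split_ifs
    · exact hf.rpow_const fun _ => Or.inr hp.le
    · exact continuous_const
  unfold firstOrderCost
  refine continuous_finsetSum _ fun i _ => continuous_finsetSum _ fun j _ =>
    Continuous.rpow_const ((hite _ _ ?_).add (hite _ _ ?_)) fun _ => Or.inr (by positivity)
  all_goals fun_prop

theorem firstOrderCost_eq_vecNorm {U : Type*} [NormedAddCommGroup U] (e : M ≃ᵢ U) (p : ℝ)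
    (N₁ N₂ : ℕ) (u y₁ y₂ : ℕ → ℕ → M) :
    firstOrderCost p N₁ N₂ u y₁ y₂ = vecNorm p N₁ N₂
      (fun i j => fwdX (fun i j => e (u i j)) i j - (e (y₁ i j) - e (u i j)))
      (fun i j => fwdY (fun i j => e (u i j)) i j - (e (y₂ i j) - e (u i j))) := by
  simp only [firstOrderCost, vecNorm, fwdX, fwdY, sub_sub_sub_cancel_right, ← dist_eq_norm,
    e.dist_eq]

theorem secondOrderCost_eq_symGradNorm (e : M ≃ᵢ U)
    (hD : ∀ x y u v : M, (D (x, y) (u, v) : ℝ) = ‖(e y - e x) - (e v - e u)‖)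
    (hS : ∀ x y₁ y₂ u y₁' v y₂' : M, (S (x, y₁) (x, y₂) (u, y₁') (v, y₂') : ℝ)
      = ‖e y₁ - e x - (e y₁' - e u) + (e y₂ - e x) - (e y₂' - e v)‖)
    (N₁ N₂ : ℕ) (u y₁ y₂ : ℕ → ℕ → M) :
    secondOrderCost D S p N₁ N₂ u y₁ y₂ = symGradNorm p N₁ N₂
      (fun i j => e (y₁ i j) - e (u i j)) (fun i j => e (y₂ i j) - e (u i j)) := by
  -- This explains the weight $2^{1-p}$: the off-diagonal entry is counted twice and carries the
  -- factor 1/2 of the symmetrized gradient.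
  have hhalf : ∀ a : ℝ, 0 ≤ a → 2 * (2⁻¹ * a) ^ p = 2 ^ (1 - p) * a ^ p := by
    intro a ha
    rw [Real.mul_rpow (by norm_num) ha, Real.inv_rpow (by norm_num), Real.rpow_sub (by norm_num),
      Real.rpow_one]
    ring
  unfold secondOrderCost symGradNorm symNorm bwdX bwdY
  refine Finset.sum_congr rfl fun i _ => Finset.sum_congr rfl fun j _ => ?_
  simp only [hD, hS, norm_smul, norm_inv, Real.norm_ofNat, mul_ite, mul_zero,
    hhalf _ (norm_nonneg _), add_sub_assoc]

theorem mtgv_eq_vectorTGV (e : M ≃ᵢ U)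
    (hD : ∀ x y u v : M, (D (x, y) (u, v) : ℝ) = ‖(e y - e x) - (e v - e u)‖)
    (hS : ∀ x y₁ y₂ u y₁' v y₂' : M, (S (x, y₁) (x, y₂) (u, y₁') (v, y₂') : ℝ)
      = ‖e y₁ - e x - (e y₁' - e u) + (e y₂ - e x) - (e y₂' - e v)‖)
    (α₀ α₁ p : ℝ) (N₁ N₂ : ℕ) (u : ℕ → ℕ → M) :
    MTGV D S α₀ α₁ p N₁ N₂ u = vectorTGV α₀ α₁ p N₁ N₂ (fun i j => e (u i j)) := by
  let Φ : (ℕ → ℕ → M) × (ℕ → ℕ → M) → (ℕ → ℕ → U) × (ℕ → ℕ → U) := fun y =>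
    (fun i j => e (y.1 i j) - e (u i j), fun i j => e (y.2 i j) - e (u i j))
  -- Every field `w` comes from the endpoints `u + w`, so both infima range over the same values.
  have hΦ : Function.Surjective Φ := fun w =>
    ⟨(fun i j => e.symm (w.1 i j + e (u i j)), fun i j => e.symm (w.2 i j + e (u i j))),
      by simp [Φ]⟩
  refine hΦ.iInf_congr Φ fun y => ?_
  rw [mtgvCost, firstOrderCost_eq_vecNorm e, secondOrderCost_eq_symGradNorm e hD hS]

theorem exists_isMTGVMinimizer_of_isometryEquiv [ProperSpace U] (e : M ≃ᵢ U)
    (hD : ∀ x y u v : M, (D (x, y) (u, v) : ℝ) = ‖(e y - e x) - (e v - e u)‖)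
    (hS : ∀ x y₁ y₂ u y₁' v y₂' : M, (S (x, y₁) (x, y₂) (u, y₁') (v, y₂') : ℝ)
      = ‖e y₁ - e x - (e y₁' - e u) + (e y₂ - e x) - (e y₂' - e v)‖)
    (hp : 0 < p) (hα₀ : 0 ≤ α₀) (hα₁ : 0 < α₁) (N₁ N₂ : ℕ) (u : ℕ → ℕ → M) :
    ∃ y₁ y₂, IsMTGVMinimizer D S α₀ α₁ p N₁ N₂ u y₁ y₂ := by
  have : ProperSpace M := ⟨fun x r => by
    rw [← e.toHomeomorph.isCompact_image]
    change IsCompact (e '' _)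
    rw [e.image_closedBall]
    exact isCompact_closedBall _ _⟩
  refine exists_isMTGVMinimizer_of_continuous hp hα₀ hα₁ u ?_
  simp only [mtgvCost, secondOrderCost_eq_symGradNorm e hD hS]
  have he := e.continuous
  exact (continuous_const.mul (continuous_firstOrderCost hp N₁ N₂ u)).add
    (continuous_const.mul ((continuous_symGradNorm (U := U) hp N₁ N₂).comp
      (f := fun y : (ℕ → ℕ → M) × (ℕ → ℕ → M) =>
        ((fun i j => e (y.1 i j) - e (u i j) : ℕ → ℕ → U),
          (fun i j => e (y.2 i j) - e (u i j) : ℕ → ℕ → U))) (by fun_prop)))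

end VectorValued

end TGVLemmas

/-! ### Signals of zero M-TGV and geodesic signals -/

section ZeroSet

variable {m : ℕ} {M : Type*} [MetricSpace M] [ChartedSpace (EuclideanSpace ℝ (Fin m)) M]
  [Bundle.RiemannianBundle (fun x : M => TangentSpace (𝓡 m) x)]
  {D : M × M → M × M → ℝ≥0} {S : M × M → M × M → M × M → M × M → ℝ≥0} {α₀ α₁ p : ℝ} {N₁ N₂ : ℕ}

theorem exists_isMTGVMinimizer_and_mtgv_eq_zero (hp : 0 < p) (hα₀ : 0 < α₀) (hα₁ : 0 < α₁)
    (hD : ∀ v : ℕ → M, IsGeodesicSeq m 2 v → D (v 1, v 2) (v 0, v 1) = 0)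
    (hS : ∀ v : ℕ → ℕ → M,
      (∀ j < 3, IsGeodesicSeq m 2 (fun i => v i j)) →
      (∀ i < 3, IsGeodesicSeq m 2 (fun j => v i j)) →
      IsGeodesicSeq m 2 (fun k => v k (2 - k)) →
      S (v 1 1, v 2 1) (v 1 1, v 1 2) (v 1 0, v 2 0) (v 0 1, v 0 2) = 0)
    {u : ℕ → ℕ → M} (hu : IsLocallyGeodesicSignal m N₁ N₂ u) :
    (∃ y₁ y₂, IsMTGVMinimizer D S α₀ α₁ p N₁ N₂ u y₁ y₂) ∧ MTGV D S α₀ α₁ p N₁ N₂ u = 0 := by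
  obtain ⟨hcol, hrow, hanti⟩ := hu
  have hsecond : secondOrderCost D S p N₁ N₂ u (fun i j => u (i + 1) j)
      (fun i j => u i (j + 1)) = 0 := by
    refine (secondOrderCost_eq_zero_iff hp).2 fun i hi j hj => ⟨?_, ?_, ?_⟩
    · rintro ⟨h1, h2⟩
      obtain ⟨i, rfl⟩ := Nat.exists_eq_add_of_le' h1
      exact hD _ (hcol j hj i (by omega))
    · rintro ⟨h1, h2⟩
      obtain ⟨j, rfl⟩ := Nat.exists_eq_add_of_le' h1
      exact hD _ (hrow i hi j (by omega))
    · rintro ⟨⟨h1, h2⟩, h3, h4⟩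
      obtain ⟨i, rfl⟩ := Nat.exists_eq_add_of_le' h1
      obtain ⟨j, rfl⟩ := Nat.exists_eq_add_of_le' h3
      refine hS (fun k l => u (i + k) (j + l)) (fun l hl => hcol (j + l) (by omega) i (by omega))
        (fun k hk => hrow (i + k) (by omega) j (by omega)) ?_
      -- The antidiagonal of the window with corner `(i, j)` starts at `(i, j + 2)`; the two index
      -- expressions agree because `k ≤ 2` keeps the natural subtractions from truncating.
      refine (hanti i (j + 2) 2 (by omega) (by omega) (by omega) 0 le_rfl).congr fun k hk => ?_
      dsimp only
      congr 1 <;> omega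
  have hcost : mtgvCost D S α₀ α₁ p N₁ N₂ u (fun i j => u (i + 1) j) (fun i j => u i (j + 1)) = 0 :=
    (mtgvCost_eq_zero_iff hα₀ hα₁).2 ⟨firstOrderCost_gradient hp N₁ N₂ u, hsecond⟩
  have hmin : IsMTGVMinimizer D S α₀ α₁ p N₁ N₂ u (fun i j => u (i + 1) j)
      (fun i j => u i (j + 1)) :=
    fun z₁ z₂ => hcost.trans_le (mtgvCost_nonneg hα₀.le hα₁.le u z₁ z₂)
  exact ⟨⟨_, _, hmin⟩, hmin.mtgv_eq.trans hcost⟩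

theorem isGeodesicSignal_of_cost_eq_zero (hp : 0 < p)
    (hD : ∀ v : ℕ → M,
      (∀ i i' : ℕ, i ≤ 2 → i' ≤ 2 → |(i : ℤ) - i'| ≤ 1 → UniqueGeodesic m (v i) (v i')) →
      D (v 1, v 2) (v 0, v 1) = 0 → IsGeodesicSeq m 2 v)
    (hS : ∀ v : ℕ → ℕ → M,
      (∀ i j i' j' : ℕ, i < 3 → j < 3 → i' < 3 → j' < 3 → UniqueGeodesic m (v i j) (v i' j')) →
      (∀ j < 3, IsGeodesicSeq m 2 (fun i => v i j)) →
      (∀ i < 3, IsGeodesicSeq m 2 (fun j => v i j)) →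
      S (v 1 1, v 2 1) (v 1 1, v 1 2) (v 1 0, v 2 0) (v 0 1, v 0 2) = 0 →
      IsGeodesicSeq m 2 (fun k => v k (2 - k)))
    {u y₁ y₂ : ℕ → ℕ → M}
    (huniq : ∀ i j i' j' : ℕ, i < N₁ → j < N₂ → i' < N₁ → j' < N₂ →
      max |(i : ℤ) - i'| |(j : ℤ) - j'| ≤ 2 → UniqueGeodesic m (u i j) (u i' j'))
    (hfirst : firstOrderCost p N₁ N₂ u y₁ y₂ = 0)
    (hsecond : secondOrderCost D S p N₁ N₂ u y₁ y₂ = 0) :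
    IsGeodesicSignal m N₁ N₂ u := by
  rw [firstOrderCost_eq_zero_iff hp] at hfirst
  rw [secondOrderCost_eq_zero_iff hp] at hsecond
  have hnear : ∀ i j i' j' : ℕ, i < N₁ → j < N₂ → i' < N₁ → j' < N₂ →
      i ≤ i' + 2 → i' ≤ i + 2 → j ≤ j' + 2 → j' ≤ j + 2 → UniqueGeodesic m (u i j) (u i' j') :=
    fun i j i' j' hi hj hi' hj' _ _ _ _ => huniq i j i' j' hi hj hi' hj'
      (max_le (abs_le.2 ⟨by omega, by omega⟩) (abs_le.2 ⟨by omega, by omega⟩))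
  have hcol : ∀ j < N₂, IsLocallyGeodesicSeq m (N₁ - 1) (fun i => u i j) := by
    intro j hj i hi
    refine hD _ (fun k k' hk hk' _ => hnear _ _ _ _ (by omega) hj (by omega) hj (by omega)
      (by omega) (by omega) (by omega)) ?_
    have h := (hsecond (i + 1) (by omega) j hj).1 ⟨by omega, by omega⟩
    rwa [(hfirst (i + 1) (by omega) j hj).1 (by omega), Nat.add_sub_cancel,
      (hfirst i (by omega) j hj).1 (by omega)] at h
  have hrow : ∀ i < N₁, IsLocallyGeodesicSeq m (N₂ - 1) (fun j => u i j) := by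
    intro i hi j hj
    refine hD _ (fun k k' hk hk' _ => hnear _ _ _ _ hi (by omega) hi (by omega) (by omega)
      (by omega) (by omega) (by omega)) ?_
    have h := (hsecond i hi (j + 1) (by omega)).2.1 ⟨by omega, by omega⟩
    rwa [(hfirst i hi (j + 1) (by omega)).2 (by omega), Nat.add_sub_cancel,
      (hfirst i hi j (by omega)).2 (by omega)] at h
  -- The `S` term at the centre `(i + 1, j + 1)` sees exactly the window with corner `(i, j)`, whose
  -- rows and columns are geodesic by `hcol` and `hrow`.
  have hanti : ∀ i j, i + 2 < N₁ → j + 2 < N₂ →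
      IsGeodesicSeq m 2 (fun k => u (i + k) (j + (2 - k))) := by
    intro i j hi hj
    refine hS (fun k l => u (i + k) (j + l)) (fun k l k' l' hk hl hk' hl' => hnear _ _ _ _
        (by omega) (by omega) (by omega) (by omega) (by omega) (by omega) (by omega) (by omega))
      (fun l hl => hcol (j + l) (by omega) i (by omega))
      (fun k hk => hrow (i + k) (by omega) j (by omega)) ?_
    have h := (hsecond (i + 1) (by omega) (j + 1) (by omega)).2.2
      ⟨⟨by omega, by omega⟩, by omega, by omega⟩
    rwa [(hfirst (i + 1) (by omega) (j + 1) (by omega)).1 (by omega),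
      (hfirst (i + 1) (by omega) (j + 1) (by omega)).2 (by omega),
      Nat.add_sub_cancel, Nat.add_sub_cancel,
      (hfirst (i + 1) (by omega) j (by omega)).1 (by omega),
      (hfirst i (by omega) (j + 1) (by omega)).2 (by omega)] at h
  refine ⟨fun j hj => (hcol j hj).isGeodesicSeq fun i hi => ?_,
    fun i hi => (hrow i hi).isGeodesicSeq fun j hj => ?_,
    fun i j n hi hj hn => IsLocallyGeodesicSeq.isGeodesicSeq (fun k hk => ?_) fun k hk => ?_⟩
  · exact hnear _ _ _ _ (by omega) hj (by omega) hj (by omega) (by omega) (by omega) (by omega)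
  · exact hnear _ _ _ _ hi (by omega) hi (by omega) (by omega) (by omega) (by omega) (by omega)
  -- Three consecutive antidiagonal points span a three-by-three window of the grid, with this
  -- corner.
  · refine (hanti (i + k) (j - k - 2) (by omega) (by omega)).congr fun l hl => ?_
    congr 1 <;> omega
  · exact hnear _ _ _ _ (by omega) (by omega) (by omega) (by omega) (by omega) (by omega)
      (by omega) (by omega)

end ZeroSet

theorem proposition2p17 {m : ℕ} {M : Type*} [MetricSpace M] [CompleteSpace M]
    [ChartedSpace (EuclideanSpace ℝ (Fin m)) M] [IsManifold (𝓡 m) ∞ M]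
    [Bundle.RiemannianBundle (fun x : M => TangentSpace (𝓡 m) x)]
    [IsContMDiffRiemannianBundle (𝓡 m) ∞ (EuclideanSpace ℝ (Fin m))
      (fun x : M => TangentSpace (𝓡 m) x)]
    [IsRiemannianManifold (𝓡 m) M]
    (α₀ α₁ p : ℝ) (hα₀ : 0 < α₀) (hα₁ : 0 < α₁) (hp : 1 ≤ p)
    (D : M × M → M × M → ℝ≥0) (S : M × M → M × M → M × M → M × M → ℝ≥0)
    (hD_zero : ∀ x u : M, D (x, x) (u, u) = 0)
    (hD_vec : ∀ (K : ℕ) (e : M ≃ᵢ EuclideanSpace ℝ (Fin K)) (x y u v : M),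
      (D (x, y) (u, v) : ℝ) = ‖(e y - e x) - (e v - e u)‖)
    (hS_zero : ∀ x u v : M, S (x, x) (x, x) (u, u) (v, v) = 0)
    (hS_vec : ∀ (K : ℕ) (e : M ≃ᵢ EuclideanSpace ℝ (Fin K)) (x y₁ y₂ u y₁' v y₂' : M),
      (S (x, y₁) (x, y₂) (u, y₁') (v, y₂') : ℝ)
        = ‖e y₁ - e x - (e y₁' - e u) + (e y₂ - e x) - (e y₂' - e v)‖) :
    -- in the vector space setting, M-TGV is the vector space TGV
    (∀ (K : ℕ) (e : M ≃ᵢ EuclideanSpace ℝ (Fin K)) (N₁ N₂ : ℕ) (u : ℕ → ℕ → M),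
      (∃ y₁ y₂, IsMTGVMinimizer D S α₀ α₁ p N₁ N₂ u y₁ y₂) ∧
      MTGV D S α₀ α₁ p N₁ N₂ u = vectorTGV α₀ α₁ p N₁ N₂ (fun i j => e (u i j))) ∧
    -- if the minimum is attained at the zero tuples, M-TGV is `α₁ TV`
    (∀ (N₁ N₂ : ℕ) (u : ℕ → ℕ → M), IsMTGVMinimizer D S α₀ α₁ p N₁ N₂ u u u →
      MTGV D S α₀ α₁ p N₁ N₂ u = α₁ * manifoldTV p N₁ N₂ u) ∧
    -- if the minimum is attained at the gradient tuples, M-TGV is `α₀ TV²`, where `TV²` is an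
    -- admissible generalization of the vector space `TV²`
    ((∀ (N₁ N₂ : ℕ) (u : ℕ → ℕ → M),
      IsMTGVMinimizer D S α₀ α₁ p N₁ N₂ u (fun i j => u (i + 1) j) (fun i j => u i (j + 1)) →
      MTGV D S α₀ α₁ p N₁ N₂ u = α₀ * manifoldTV2 D S p N₁ N₂ u) ∧
     ∀ (K : ℕ) (e : M ≃ᵢ EuclideanSpace ℝ (Fin K)) (N₁ N₂ : ℕ) (u : ℕ → ℕ → M),
      manifoldTV2 D S p N₁ N₂ u = vectorTV2 p N₁ N₂ (fun i j => e (u i j))) ∧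
    -- locally geodesic signals are in the zero set
    ((∀ v : ℕ → M, IsGeodesicSeq m 2 v → D (v 1, v 2) (v 0, v 1) = 0) →
     (∀ v : ℕ → ℕ → M,
      (∀ j < 3, IsGeodesicSeq m 2 (fun i => v i j)) →
      (∀ i < 3, IsGeodesicSeq m 2 (fun j => v i j)) →
      IsGeodesicSeq m 2 (fun k => v k (2 - k)) →
      S (v 1 1, v 2 1) (v 1 1, v 1 2) (v 1 0, v 2 0) (v 0 1, v 0 2) = 0) →
     ∀ (N₁ N₂ : ℕ) (u : ℕ → ℕ → M), IsLocallyGeodesicSignal m N₁ N₂ u →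
      (∃ y₁ y₂, IsMTGVMinimizer D S α₀ α₁ p N₁ N₂ u y₁ y₂) ∧
      MTGV D S α₀ α₁ p N₁ N₂ u = 0) ∧
    -- conversely, signals in the zero set are geodesic, under uniqueness of geodesics
    ((∀ v : ℕ → M,
      (∀ i i' : ℕ, i ≤ 2 → i' ≤ 2 → |(i : ℤ) - i'| ≤ 1 → UniqueGeodesic m (v i) (v i')) →
      D (v 1, v 2) (v 0, v 1) = 0 → IsGeodesicSeq m 2 v) →
     (∀ v : ℕ → ℕ → M,
      (∀ i j i' j' : ℕ, i < 3 → j < 3 → i' < 3 → j' < 3 → UniqueGeodesic m (v i j) (v i' j')) →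
      (∀ j < 3, IsGeodesicSeq m 2 (fun i => v i j)) →
      (∀ i < 3, IsGeodesicSeq m 2 (fun j => v i j)) →
      S (v 1 1, v 2 1) (v 1 1, v 1 2) (v 1 0, v 2 0) (v 0 1, v 0 2) = 0 →
      IsGeodesicSeq m 2 (fun k => v k (2 - k))) →
     ∀ (N₁ N₂ : ℕ) (u : ℕ → ℕ → M),
      (∀ i j i' j' : ℕ, i < N₁ → j < N₂ → i' < N₁ → j' < N₂ →
        max |(i : ℤ) - i'| |(j : ℤ) - j'| ≤ 2 → UniqueGeodesic m (u i j) (u i' j')) →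
      (∃ y₁ y₂, IsMTGVMinimizer D S α₀ α₁ p N₁ N₂ u y₁ y₂) →
      MTGV D S α₀ α₁ p N₁ N₂ u = 0 →
      IsGeodesicSignal m N₁ N₂ u) := by
  have hp0 : 0 < p := one_pos.trans_le hp
  refine ⟨fun K e N₁ N₂ u => ⟨?_, ?_⟩, fun N₁ N₂ u h => ?_,
    ⟨fun N₁ N₂ u h => ?_, fun K e N₁ N₂ u => ?_⟩,
    fun hD hS N₁ N₂ u hu => ?_, fun hD hS N₁ N₂ u huniq ⟨y₁, y₂, hy⟩ hzero => ?_⟩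
  · exact exists_isMTGVMinimizer_of_isometryEquiv e (hD_vec K e) (hS_vec K e) hp0 hα₀.le hα₁ N₁ N₂ u
  · exact mtgv_eq_vectorTGV e (hD_vec K e) (hS_vec K e) α₀ α₁ p N₁ N₂ u
  · have hsecond : secondOrderCost D S p N₁ N₂ u u u = 0 :=
      (secondOrderCost_eq_zero_iff hp0).2 fun _ _ _ _ =>
        ⟨fun _ => hD_zero _ _, fun _ => hD_zero _ _, fun _ => hS_zero _ _ _⟩
    rw [h.mtgv_eq, mtgvCost, hsecond, mul_zero, add_zero]
    rfl
  · rw [h.mtgv_eq, mtgvCost, firstOrderCost_gradient hp0, mul_zero, zero_add]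
    rfl
  · exact secondOrderCost_eq_symGradNorm e (hD_vec K e) (hS_vec K e) N₁ N₂ u _ _
  · exact exists_isMTGVMinimizer_and_mtgv_eq_zero hp0 hα₀ hα₁ hD hS hu
  -- Attainment turns the value zero into a pair whose cost is zero; a vanishing infimum alone would
  -- not provide one.
  · rw [hy.mtgv_eq, mtgvCost_eq_zero_iff hα₀ hα₁] at hzero
    exact isGeodesicSignal_of_cost_eq_zero hp0 hD hS huniq hzero.1 hzero.2
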